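/- **Setting.** Let $N\ge 2$ clients have data distributions $\mathcal D_1,\dots,\mathcal D_N$ on $\mathcal X\times\{1,\dots,K\}$. Client $i$ holds $m_i\ge 1$ samples $(x_i^j,y_i^j)$, $j=1,\dots,m_i$, drawn from $\mathcal D_i$, all samples of all clients being independent, and $M=\sum_{i=1}^N m_i$. Let $\Theta_g\subseteq\mathbb R^p$ be the set of admissible global prompts and $\Theta_{l,i}\subseteq\mathbb R^q$ the set of admissible local prompts of client $i$ (for instance the whole spaces). For prompts $P_g\in\Theta_g$, $P_l\in\Theta_{l,i}$ let $f(P_g,P_l;\cdot):\mathcal X\to\mathbb R^K$ be the personalized model, and let $\ell:\mathbb R^K\times\{1,\dots,K\}\to\mathbb R$ be the loss. Put $$\mathcal L_{\mathcal D_i}(P_g,P_l)=\mathbb E_{(x,y)\sim\mathcal D_i}\,\ell(f(P_g,P_l;x),y),\qquad \mathcal L_{\hat{\mathcal D}_i}(P_g,P_l)=\frac1{m_i}\sum_{j=1}^{m_i}\ell(f(P_g,P_l;x_i^j),y_i^j).$$ Assume that the loss of a single sample satisfies $0\le \ell(f(P_g,P_l;x),y)\le M$ for all admissible prompts and all $(x,y)$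 (so that changing one sample changes the weighted empirical loss $\sum_i\frac{m_i}{M}\mathcal L_{\hat{\mathcal D}_i}$ by at most $1$). Let $\mathcal H=\{f(P_g,P_l;\cdot): P_g\in\Theta_g,\ P_l\in\Theta_{l,i}\text{ for some } i\}$ be the personalized hypothesis class and let $d$ be its VC-dimension, assumed finite and at least $1$; here the VC-dimension of a class of score functions $h:\mathcal X\to\mathbb R^K$ is that of the family of subgraphs $\{(x,k,t): t<h(x)_k\}$. **Assumption 1.** There are constants $L,L_g,L_{l,i}\ge0$ such that for every client $i$, all $P_g,P_g'\in\Theta_g$, $P_l,P_l'\in\Theta_{l,i}$ and all $x,y$, $$|\ell(f(P_g,P_l;x),y)-\ell(f(P_g',P_l';x),y)|\le L\|f(P_g,P_l;x)-f(P_g',P_l';x)\|,$$ $$\|f(P_g,P_l;x)-f(P_g',P_l;x)\|\le L_g\|P_g-P_g'\|_2,\qquad \|f(P_g,P_l;x)-f(P_g,P_l';x)\|\le L_{l,i}\|P_l-P_l'\|_2 .$$ **Assumption 2.** Let $P_g^\ast\in\Theta_g$, $P_{l,i}^\ast\in\Theta_{l,i}$ be optimal for the real distributions, i.e. minimizers of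 $\sum_{i=1}^N\frac{m_i}{M}\mathcal L_{\mathcal D_i}(P_g,P_{l,i})$ over the admissible prompts (the federated objective when all clients participate). Let $\hat P_g\in\Theta_g$, $\hat P_{l,i}\in\Theta_{l,i}$ be the learned prompts, which may depend on the samples in any way (for instance the output of federated training in which all clients participate in every round). Almost surely $\|\hat P_g-P_g^\ast\|_2\le A_g$ and $\|\hat P_{l,i}-P_{l,i}^\ast\|_2\le A_{l,i}$ for every $i$. **Theorem 1 (Generalization Bound of FedOTP).** For every $\delta\in(0,1)$, with probability at least $1-\delta$, $$\left|\sum_{i=1}^N\frac{m_i}{M}\Big(\mathcal L_{\hat{\mathcal D}_i}(\hat P_g,\hat P_{l,i})-\mathcal L_{\mathcal D_i}(P_g^\ast,P_{l,i}^\ast)\Big)\right|\le\sqrt{\frac M2\log\frac N\delta}+\sqrt{\frac{dN}{M}\log\frac{eM}{d}}+L\,(L_gA_g+L_lA_l),$$ where $L_l=\sqrt{\sum_{i=1}^N L_{l,i}^2}$ and $A_l=\sqrt{\sum_{i=1}^N A_{l,i}^2}$. (If $d>eM$, the second term is read as $0$.) -/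

import Mathlib

open MeasureTheory ProbabilityTheory
open scoped BigOperators

namespace FedOTP

noncomputable section

/-- A family `C` of subsets of `α` shatters the finite set `S` if every subset of `S` is cut out of
`S` by a member of `C`. -/
def Shatters {α : Type*} (C : Set (Set α)) (S : Finset α) : Prop :=
  ∀ T : Finset α, T ⊆ S → ∃ c ∈ C, ∀ a ∈ S, a ∈ c ↔ a ∈ T

/-- The Vapnik-Chervonenkis dimension of a family of subsets: the supremum (possibly infinite) of
the cardinalities of the finite sets that it shatters. -/
def vcDim {α : Type*} (C : Set (Set α)) : ℕ∞ :=
  ⨆ (S : Finset α) (_ : Shatters C S), (S.card : ℕ∞)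

/-- The subgraph of a multi-class scoring hypothesis `h`, seen as the real-valued function
`(x, k) ↦ h x k` of an input and a class. -/
def subgraph {X : Type*} {K : ℕ} (h : X → EuclideanSpace ℝ (Fin K)) : Set ((X × Fin K) × ℝ) :=
  {q | q.2 < h q.1.1 q.1.2}

/-- The VC-dimension of a class of multi-class scoring hypotheses: the VC-dimension of the family
of their subgraphs (the usual VC-dimension of a class of real-valued functions). -/
def hypothesisVCDim {X : Type*} {K : ℕ} (H : Set (X → EuclideanSpace ℝ (Fin K))) : ℕ∞ :=
  vcDim (subgraph '' H)

variable {X : Type*} {N K p q : ℕ}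

/-- The personalized hypothesis class: all models `f (Pg, Pl; ·)` with an admissible global prompt
and an admissible local prompt of some client. -/
def personalizedClass
    (f : EuclideanSpace ℝ (Fin p) → EuclideanSpace ℝ (Fin q) → X → EuclideanSpace ℝ (Fin K))
    (Θg : Set (EuclideanSpace ℝ (Fin p))) (Θl : Fin N → Set (EuclideanSpace ℝ (Fin q))) :
    Set (X → EuclideanSpace ℝ (Fin K)) :=
  {h | ∃ i, ∃ Pg ∈ Θg, ∃ Pl ∈ Θl i, h = f Pg Pl}

/-- The expected loss of the prompts `(Pg, Pl)` under the data distribution `D`. -/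
def trueLoss [MeasurableSpace X]
    (f : EuclideanSpace ℝ (Fin p) → EuclideanSpace ℝ (Fin q) → X → EuclideanSpace ℝ (Fin K))
    (ℓ : EuclideanSpace ℝ (Fin K) → Fin K → ℝ) (D : Measure (X × Fin K))
    (Pg : EuclideanSpace ℝ (Fin p)) (Pl : EuclideanSpace ℝ (Fin q)) : ℝ :=
  ∫ z, ℓ (f Pg Pl z.1) z.2 ∂D

/-- The average loss of the prompts `(Pg, Pl)` over a data set of `m` labelled samples. -/
def empiricalLoss
    (f : EuclideanSpace ℝ (Fin p) → EuclideanSpace ℝ (Fin q) → X → EuclideanSpace ℝ (Fin K))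
    (ℓ : EuclideanSpace ℝ (Fin K) → Fin K → ℝ) {m : ℕ} (S : Fin m → X × Fin K)
    (Pg : EuclideanSpace ℝ (Fin p)) (Pl : EuclideanSpace ℝ (Fin q)) : ℝ :=
  (∑ j, ℓ (f Pg Pl (S j).1) (S j).2) / m

/-- The total number of samples. -/
def totalSamples (m : Fin N → ℕ) : ℕ := ∑ i, m i

/-- The true federated objective when all clients participate: the sample-weighted average of the
expected losses of the clients, with a common global prompt and one local prompt per client. -/
def trueObjective [MeasurableSpace X]
    (f : EuclideanSpace ℝ (Fin p) → EuclideanSpace ℝ (Fin q) → X → EuclideanSpace ℝ (Fin K))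
    (ℓ : EuclideanSpace ℝ (Fin K) → Fin K → ℝ) (D : Fin N → Measure (X × Fin K)) (m : Fin N → ℕ)
    (Pg : EuclideanSpace ℝ (Fin p)) (Pl : Fin N → EuclideanSpace ℝ (Fin q)) : ℝ :=
  ∑ i, (m i : ℝ) / (totalSamples m : ℝ) * trueLoss f ℓ (D i) Pg (Pl i)

/-- `(Pg, Pl)` are optimal prompts for the real distributions: they are admissible and minimize the
true federated objective over all admissible prompts. -/
def IsOptimal [MeasurableSpace X]
    (f : EuclideanSpace ℝ (Fin p) → EuclideanSpace ℝ (Fin q) → X → EuclideanSpace ℝ (Fin K))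
    (ℓ : EuclideanSpace ℝ (Fin K) → Fin K → ℝ) (D : Fin N → Measure (X × Fin K)) (m : Fin N → ℕ)
    (Θg : Set (EuclideanSpace ℝ (Fin p))) (Θl : Fin N → Set (EuclideanSpace ℝ (Fin q)))
    (Pg : EuclideanSpace ℝ (Fin p)) (Pl : Fin N → EuclideanSpace ℝ (Fin q)) : Prop :=
  Pg ∈ Θg ∧ (∀ i, Pl i ∈ Θl i) ∧
    ∀ Pg' ∈ Θg, ∀ Pl' : Fin N → EuclideanSpace ℝ (Fin q), (∀ i, Pl' i ∈ Θl i) →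
      trueObjective f ℓ D m Pg Pl ≤ trueObjective f ℓ D m Pg' Pl'

/-- The Lipschitz conditions: the loss is `L`-Lipschitz in the output of the personalized model, and
the personalized model is `Lg`-Lipschitz in the global prompt and, for client `i`, `Ll i`-Lipschitz
in the local prompt, uniformly over the inputs. -/
structure LipschitzConditions
    (f : EuclideanSpace ℝ (Fin p) → EuclideanSpace ℝ (Fin q) → X → EuclideanSpace ℝ (Fin K))
    (ℓ : EuclideanSpace ℝ (Fin K) → Fin K → ℝ)
    (Θg : Set (EuclideanSpace ℝ (Fin p))) (Θl : Fin N → Set (EuclideanSpace ℝ (Fin q)))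
    (L Lg : ℝ) (Ll : Fin N → ℝ) : Prop where
  loss : ∀ i, ∀ Pg ∈ Θg, ∀ Pg' ∈ Θg, ∀ Pl ∈ Θl i, ∀ Pl' ∈ Θl i, ∀ x y,
    |ℓ (f Pg Pl x) y - ℓ (f Pg' Pl' x) y| ≤ L * ‖f Pg Pl x - f Pg' Pl' x‖
  globalPrompt : ∀ i, ∀ Pg ∈ Θg, ∀ Pg' ∈ Θg, ∀ Pl ∈ Θl i, ∀ x,
    ‖f Pg Pl x - f Pg' Pl x‖ ≤ Lg * ‖Pg - Pg'‖
  localPrompt : ∀ i, ∀ Pg ∈ Θg, ∀ Pl ∈ Θl i, ∀ Pl' ∈ Θl i, ∀ x,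
    ‖f Pg Pl x - f Pg Pl' x‖ ≤ Ll i * ‖Pl - Pl'‖

end

end FedOTP

namespace FedOTP

/-! The true loss is taken at the optimal prompts, which do not depend on the samples, so no uniform
convergence is needed. Insert the empirical loss at the optimal prompts. The change from learned to
optimal prompts is deterministic once the distance bounds hold: the Lipschitz conditions bound it
client by client, and Cauchy–Schwarz (`sum_weight_mul_mul_le`) combines the local parts. What
remains is a sum of independent terms with fixed prompts, each sample contributing its loss divided
by the total sample size, a number in `[0, 1]`. Hoeffding's inequality controls it by the first
square root; the VC term only adds nonnegative slack. -/

open Real in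
/-- **Hoeffding's inequality**, two-sided, for independent random variables with values in
`[0, 1]`. -/
theorem measureReal_lt_abs_sum_sub_integral_le {ι Ω : Type*} [Fintype ι] [MeasurableSpace Ω]
    {μ : Measure Ω} [IsProbabilityMeasure μ] {Y : ι → Ω → ℝ} (hY : ∀ a, Measurable (Y a))
    (hindep : iIndepFun Y μ) (hmem : ∀ a ω, Y a ω ∈ Set.Icc (0 : ℝ) 1) {ε : ℝ} (hε : 0 ≤ ε) :
    μ.real {ω | ε < |∑ a, (Y a ω - ∫ ω', Y a ω' ∂μ)|}
      ≤ 2 * exp (-(2 * ε ^ 2 / Fintype.card ι)) := by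
  set W : ι → Ω → ℝ := fun a ω => Y a ω - ∫ ω', Y a ω' ∂μ with hW
  -- Hoeffding's lemma: a centred variable with range of length 1 has variance proxy 1/4.
  have hsub : ∀ a, HasSubgaussianMGF (W a) ((‖(1 : ℝ) - 0‖₊ / 2) ^ 2) μ := fun a =>
    hasSubgaussianMGF_of_mem_Icc (hY a).aemeasurable (.of_forall (hmem a))
  have hWindep : iIndepFun W μ :=
    hindep.comp (fun a x => x - ∫ ω', Y a ω' ∂μ) fun a => measurable_id.sub_const _
  have hnegindep : iIndepFun (fun a => -W a) μ :=
    hWindep.comp (fun _ x => -x) fun _ => measurable_neg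
  have hexp : -ε ^ 2 / (2 * ((∑ _a : ι, (‖(1 : ℝ) - 0‖₊ / 2) ^ 2 : NNReal) : ℝ))
      = -(2 * ε ^ 2 / Fintype.card ι) := by
    -- For empty `ι` both exponents are divisions by zero, hence 0.
    rcases eq_or_ne (Fintype.card ι : ℝ) 0 with h | h
    · simp [h]
    · simp only [sub_zero, nnnorm_one, Finset.sum_const, Finset.card_univ, nsmul_eq_mul,
        NNReal.coe_mul, NNReal.coe_natCast, NNReal.coe_pow, NNReal.coe_div, NNReal.coe_one,
        NNReal.coe_ofNat]
      field_simp
  have hupper := HasSubgaussianMGF.measure_sum_ge_le_of_iIndepFun (s := Finset.univ) hWindep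
    (fun a _ => hsub a) hε
  have hlower := HasSubgaussianMGF.measure_sum_ge_le_of_iIndepFun (s := Finset.univ) hnegindep
    (fun a _ => (hsub a).neg) hε
  rw [hexp] at hupper hlower
  calc μ.real {ω | ε < |∑ a, W a ω|}
      ≤ μ.real ({ω | ε ≤ ∑ a, W a ω} ∪ {ω | ε ≤ ∑ a, (-W a) ω}) := by
        refine measureReal_mono fun ω hω => ?_
        rcases lt_abs.1 (show ε < |∑ a, W a ω| from hω) with h | h
        · exact Or.inl h.le
        · refine Or.inr ?_
          simpa [Finset.sum_neg_distrib] using h.le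
    _ ≤ _ := measureReal_union_le _ _
    _ ≤ _ := by linarith

variable {X : Type*} {N K p q : ℕ}

/-- The empirical loss of client `i` is Lipschitz in the prompts. -/
theorem LipschitzConditions.abs_empiricalLoss_sub_le
    {f : EuclideanSpace ℝ (Fin p) → EuclideanSpace ℝ (Fin q) → X → EuclideanSpace ℝ (Fin K)}
    {ℓ : EuclideanSpace ℝ (Fin K) → Fin K → ℝ}
    {Θg : Set (EuclideanSpace ℝ (Fin p))} {Θl : Fin N → Set (EuclideanSpace ℝ (Fin q))}
    {L Lg : ℝ} {Ll : Fin N → ℝ} (hlip : LipschitzConditions f ℓ Θg Θl L Lg Ll) (hL : 0 ≤ L)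
    {n : ℕ} (hn : 0 < n) (S : Fin n → X × Fin K) {i : Fin N}
    {Pg Pg' : EuclideanSpace ℝ (Fin p)} (hPg : Pg ∈ Θg) (hPg' : Pg' ∈ Θg)
    {Pl Pl' : EuclideanSpace ℝ (Fin q)} (hPl : Pl ∈ Θl i) (hPl' : Pl' ∈ Θl i) :
    |empiricalLoss f ℓ S Pg Pl - empiricalLoss f ℓ S Pg' Pl'|
      ≤ L * (Lg * ‖Pg - Pg'‖ + Ll i * ‖Pl - Pl'‖) := by
  have hn' : (0 : ℝ) < n := by exact_mod_cast hn
  have key : ∀ z : X × Fin K, |ℓ (f Pg Pl z.1) z.2 - ℓ (f Pg' Pl' z.1) z.2|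
      ≤ L * (Lg * ‖Pg - Pg'‖ + Ll i * ‖Pl - Pl'‖) := fun z => by
    refine (hlip.loss i Pg hPg Pg' hPg' Pl hPl Pl' hPl' z.1 z.2).trans
      (mul_le_mul_of_nonneg_left ?_ hL)
    -- The mixed pair `(Pg', Pl)` is admissible, so the prompts can be changed one at a time.
    refine (norm_sub_le_norm_sub_add_norm_sub _ (f Pg' Pl z.1) _).trans (add_le_add ?_ ?_)
    · exact hlip.globalPrompt i Pg hPg Pg' hPg' Pl hPl z.1
    · exact hlip.localPrompt i Pg' hPg' Pl hPl Pl' hPl' z.1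
  rw [empiricalLoss, empiricalLoss, ← sub_div, ← Finset.sum_sub_distrib, abs_div,
    abs_of_pos hn', div_le_iff₀ hn']
  refine (Finset.abs_sum_le_sum_abs _ _).trans ((Finset.sum_le_sum fun j _ => key (S j)).trans ?_)
  simp [mul_comm]

/-- A weighted average of the products `a i * b i` of nonnegative reals is at most the product of
the Euclidean norms of `a` and `b`. -/
theorem sum_weight_mul_mul_le {ι : Type*} [Fintype ι] {w a b : ι → ℝ} (hw : ∀ i, w i ≤ 1)
    (ha : ∀ i, 0 ≤ a i) (hb : ∀ i, 0 ≤ b i) :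
    ∑ i, w i * (a i * b i) ≤ √(∑ i, a i ^ 2) * √(∑ i, b i ^ 2) :=
  (Finset.sum_le_sum fun i _ => mul_le_of_le_one_left (mul_nonneg (ha i) (hb i)) (hw i)).trans
    (Real.sum_mul_le_sqrt_mul_sqrt _ _ _)

theorem totalSamples_pos {m : Fin N → ℕ} (hN : 0 < N) (hm : ∀ i, 0 < m i) :
    0 < totalSamples m :=
  Finset.sum_pos (fun i _ => hm i) ⟨⟨0, hN⟩, Finset.mem_univ _⟩

theorem sum_div_totalSamples {m : Fin N → ℕ} (h : 0 < totalSamples m) :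
    ∑ i, (m i : ℝ) / (totalSamples m : ℝ) = 1 := by
  have h' : (totalSamples m : ℝ) ≠ 0 := by exact_mod_cast h.ne'
  rw [← Finset.sum_div, ← Nat.cast_sum]
  exact div_self h'

/-- Concentration of the weighted empirical loss of fixed prompts around the true objective. -/
theorem measureReal_lt_abs_weighted_empiricalLoss_sub_trueLoss_le
    [MeasurableSpace X] {Ω : Type*} [MeasurableSpace Ω] {μ : Measure Ω} [IsProbabilityMeasure μ]
    {f : EuclideanSpace ℝ (Fin p) → EuclideanSpace ℝ (Fin q) → X → EuclideanSpace ℝ (Fin K)}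
    {ℓ : EuclideanSpace ℝ (Fin K) → Fin K → ℝ} (hℓ : ∀ y, Measurable fun u => ℓ u y)
    {D : Fin N → Measure (X × Fin K)} {m : Fin N → ℕ} (hm : ∀ i, 0 < m i)
    (hM : 0 < totalSamples m) {Z : (i : Fin N) → Fin (m i) → Ω → X × Fin K}
    (hZmeas : ∀ i j, Measurable (Z i j)) (hZlaw : ∀ i j, μ.map (Z i j) = D i)
    (hZindep : iIndepFun (fun a : (i : Fin N) × Fin (m i) => Z a.1 a.2) μ)
    {Pg : EuclideanSpace ℝ (Fin p)} {Pl : Fin N → EuclideanSpace ℝ (Fin q)}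
    (hf : ∀ i, Measurable (f Pg (Pl i)))
    (hbdd : ∀ i x y, 0 ≤ ℓ (f Pg (Pl i) x) y ∧ ℓ (f Pg (Pl i) x) y ≤ (totalSamples m : ℝ))
    {ε : ℝ} (hε : 0 ≤ ε) :
    μ.real {ω | ε < |∑ i, (m i : ℝ) / (totalSamples m : ℝ) *
        (empiricalLoss f ℓ (fun j => Z i j ω) Pg (Pl i) - trueLoss f ℓ (D i) Pg (Pl i))|}
      ≤ 2 * Real.exp (-(2 * ε ^ 2 / totalSamples m)) := by
  have hM' : (0 : ℝ) < totalSamples m := by exact_mod_cast hM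
  -- The weight `m i / totalSamples m` cancels the `1 / m i` of the empirical average, leaving this
  -- contribution per sample.
  let g : Fin N → X × Fin K → ℝ := fun i z => ℓ (f Pg (Pl i) z.1) z.2 / totalSamples m
  have hg : ∀ i, Measurable (g i) := fun i =>
    (measurable_from_prod_countable_left fun y => (hℓ y).comp (hf i)).div_const _
  have hcard : Fintype.card ((i : Fin N) × Fin (m i)) = totalSamples m := by
    simp [totalSamples]
  have hint : ∀ i j, ∫ ω, g i (Z i j ω) ∂μ = trueLoss f ℓ (D i) Pg (Pl i) / totalSamples m := by
    intro i j
    rw [← integral_map (hZmeas i j).aemeasurable (hg i).aestronglyMeasurable, hZlaw, trueLoss,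
      integral_div]
  have hoeffding := measureReal_lt_abs_sum_sub_integral_le (μ := μ)
    (Y := fun (a : (i : Fin N) × Fin (m i)) ω => g a.1 (Z a.1 a.2 ω))
    (fun a => (hg a.1).comp (hZmeas a.1 a.2))
    (hZindep.comp (fun a => g a.1) fun a => hg a.1)
    (fun a ω => ⟨div_nonneg (hbdd _ _ _).1 hM'.le, (div_le_one hM').2 (hbdd _ _ _).2⟩) hε
  rw [hcard] at hoeffding
  convert hoeffding using 7 with ω
  rw [Fintype.sum_sigma]
  refine Finset.sum_congr rfl fun i _ => ?_
  have hmi : (m i : ℝ) ≠ 0 := by exact_mod_cast (hm i).ne'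
  simp only [hint, Finset.sum_sub_distrib, g, empiricalLoss, ← Finset.sum_div,
    Finset.sum_const, Finset.card_univ, Fintype.card_fin, nsmul_eq_mul]
  field_simp

end FedOTP

theorem theorem1
    {X : Type*} [MeasurableSpace X] {Ω : Type*} [MeasurableSpace Ω]
    (μ : Measure Ω) [IsProbabilityMeasure μ]
    {N K p q : ℕ} (hN : 2 ≤ N)
    -- the personalized model and the loss
    (f : EuclideanSpace ℝ (Fin p) → EuclideanSpace ℝ (Fin q) → X → EuclideanSpace ℝ (Fin K))
    (ℓ : EuclideanSpace ℝ (Fin K) → Fin K → ℝ) (hℓ : ∀ y, Measurable fun u => ℓ u y)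
    -- the admissible global prompts and the admissible local prompts of each client
    (Θg : Set (EuclideanSpace ℝ (Fin p))) (Θl : Fin N → Set (EuclideanSpace ℝ (Fin q)))
    (hf : ∀ i, ∀ Pg ∈ Θg, ∀ Pl ∈ Θl i, Measurable (f Pg Pl))
    -- the real data distributions, and independent samples from them
    (D : Fin N → Measure (X × Fin K)) [∀ i, IsProbabilityMeasure (D i)]
    (m : Fin N → ℕ) (hm : ∀ i, 0 < m i)
    (Z : (i : Fin N) → Fin (m i) → Ω → X × Fin K)
    (hZmeas : ∀ i j, Measurable (Z i j))
    (hZlaw : ∀ i j, μ.map (Z i j) = D i)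
    (hZindep : iIndepFun (fun a : (i : Fin N) × Fin (m i) => Z a.1 a.2) μ)
    -- the loss of a single sample lies between `0` and the total number of samples
    (hbdd : ∀ i, ∀ Pg ∈ Θg, ∀ Pl ∈ Θl i, ∀ x y,
      0 ≤ ℓ (f Pg Pl x) y ∧ ℓ (f Pg Pl x) y ≤ (FedOTP.totalSamples m : ℝ))
    -- the VC-dimension of the personalized hypothesis class
    (d : ℕ) (hd : FedOTP.hypothesisVCDim (FedOTP.personalizedClass f Θg Θl) = (d : ℕ∞))
    (hd_pos : 1 ≤ d)
    -- the Lipschitz conditions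
    (L Lg : ℝ) (Ll : Fin N → ℝ) (hL : 0 ≤ L) (hLg : 0 ≤ Lg) (hLl : ∀ i, 0 ≤ Ll i)
    (hlip : FedOTP.LipschitzConditions f ℓ Θg Θl L Lg Ll)
    -- the optimal prompts, and the learned prompts (which may depend on the samples)
    (PgOpt : EuclideanSpace ℝ (Fin p)) (PlOpt : Fin N → EuclideanSpace ℝ (Fin q))
    (hopt : FedOTP.IsOptimal f ℓ D m Θg Θl PgOpt PlOpt)
    (PgHat : Ω → EuclideanSpace ℝ (Fin p)) (PlHat : Fin N → Ω → EuclideanSpace ℝ (Fin q))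
    (hPgHat : ∀ ω, PgHat ω ∈ Θg) (hPlHat : ∀ i ω, PlHat i ω ∈ Θl i)
    -- the distances between learned and optimal prompts
    (Ag : ℝ) (Al : Fin N → ℝ)
    (hAg : ∀ᵐ ω ∂μ, ‖PgHat ω - PgOpt‖ ≤ Ag)
    (hAl : ∀ i, ∀ᵐ ω ∂μ, ‖PlHat i ω - PlOpt i‖ ≤ Al i)
    (δ : ℝ) (hδ0 : 0 < δ) (hδ1 : δ < 1) :
    μ {ω | ¬ |∑ i, (m i : ℝ) / (FedOTP.totalSamples m : ℝ) *
            (FedOTP.empiricalLoss f ℓ (fun j => Z i j ω) (PgHat ω) (PlHat i ω)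
              - FedOTP.trueLoss f ℓ (D i) PgOpt (PlOpt i))|
          ≤ √((FedOTP.totalSamples m : ℝ) / 2 * Real.log ((N : ℝ) / δ))
            + √((d : ℝ) * N / (FedOTP.totalSamples m : ℝ)
                * Real.log (Real.exp 1 * (FedOTP.totalSamples m : ℝ) / d))
            + L * (Lg * Ag + √(∑ i, Ll i ^ 2) * √(∑ i, Al i ^ 2))}
      ≤ ENNReal.ofReal δ := by
  have hM : 0 < FedOTP.totalSamples m := FedOTP.totalSamples_pos (by omega) hm
  have hM' : (0 : ℝ) < FedOTP.totalSamples m := by exact_mod_cast hM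
  have hN' : (2 : ℝ) ≤ N := by exact_mod_cast hN
  obtain ⟨hgOpt, hlOpt, -⟩ := hopt
  set w : Fin N → ℝ := fun i => (m i : ℝ) / (FedOTP.totalSamples m : ℝ)
  have hw0 : ∀ i, 0 ≤ w i := fun i => by positivity
  have hwsum : ∑ i, w i = 1 := FedOTP.sum_div_totalSamples hM
  have hw1 : ∀ i, w i ≤ 1 := fun i =>
    hwsum ▸ Finset.single_le_sum (fun j _ => hw0 j) (Finset.mem_univ i)
  set ε := √((FedOTP.totalSamples m : ℝ) / 2 * Real.log ((N : ℝ) / δ))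
  have hlog : 0 ≤ Real.log ((N : ℝ) / δ) :=
    Real.log_nonneg ((one_le_div hδ0).2 (by linarith))
  have htail := FedOTP.measureReal_lt_abs_weighted_empiricalLoss_sub_trueLoss_le hℓ hm hM hZmeas
    hZlaw hZindep (fun i => hf i PgOpt hgOpt (PlOpt i) (hlOpt i))
    (fun i x y => hbdd i PgOpt hgOpt (PlOpt i) (hlOpt i) x y) (Real.sqrt_nonneg _ : 0 ≤ ε)
  -- `ε` makes the exponential equal to `δ / N`; the two-sided factor 2 is absorbed by `2 ≤ N`.
  have hδ : 2 * Real.exp (-(2 * ε ^ 2 / FedOTP.totalSamples m)) ≤ δ := by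
    have hexponent : 2 * ε ^ 2 / FedOTP.totalSamples m = Real.log ((N : ℝ) / δ) := by
      rw [Real.sq_sqrt (by positivity)]
      field_simp
    rw [hexponent, Real.exp_neg, Real.exp_log (by positivity), inv_div, ← mul_div_assoc,
      div_le_iff₀ (by linarith), mul_comm]
    exact mul_le_mul_of_nonneg_left hN' hδ0.le
  -- Up to a null set, the failure event lies in the Hoeffding event. Monotonicity of the outer
  -- measure suffices, so the learned prompts need not be measurable in `ω`.
  refine le_trans (measure_mono_ae ?_)
    ((ofReal_measureReal (μ := μ)).symm.le.trans (ENNReal.ofReal_le_ofReal (htail.trans hδ)))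
  filter_upwards [hAg, ae_all_iff.2 hAl] with ω hg hl hω
  refine lt_of_not_ge fun hε => hω ?_
  have hAl0 : ∀ i, 0 ≤ Al i := fun i => (norm_nonneg _).trans (hl i)
  have hprompt : |∑ i, w i * (FedOTP.empiricalLoss f ℓ (fun j => Z i j ω) (PgHat ω) (PlHat i ω)
      - FedOTP.empiricalLoss f ℓ (fun j => Z i j ω) PgOpt (PlOpt i))|
      ≤ L * (Lg * Ag + √(∑ i, Ll i ^ 2) * √(∑ i, Al i ^ 2)) := by
    calc _ ≤ ∑ i, w i * (L * (Lg * Ag + Ll i * Al i)) := by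
          refine (Finset.abs_sum_le_sum_abs _ _).trans (Finset.sum_le_sum fun i _ => ?_)
          rw [abs_mul, abs_of_nonneg (hw0 i)]
          refine mul_le_mul_of_nonneg_left ?_ (hw0 i)
          refine (hlip.abs_empiricalLoss_sub_le hL (hm i) _ (hPgHat ω) hgOpt (hPlHat i ω)
            (hlOpt i)).trans (mul_le_mul_of_nonneg_left ?_ hL)
          exact add_le_add (mul_le_mul_of_nonneg_left hg hLg)
            (mul_le_mul_of_nonneg_left (hl i) (hLl i))
      _ = L * (Lg * Ag + ∑ i, w i * (Ll i * Al i)) := by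
          simp only [mul_left_comm (w _) L, ← Finset.mul_sum, mul_add, Finset.sum_add_distrib,
            ← Finset.sum_mul, hwsum, one_mul]
      _ ≤ _ := by
          gcongr
          exact FedOTP.sum_weight_mul_mul_le hw1 hLl hAl0
  have hsplit : ∑ i, w i * (FedOTP.empiricalLoss f ℓ (fun j => Z i j ω) (PgHat ω) (PlHat i ω)
        - FedOTP.trueLoss f ℓ (D i) PgOpt (PlOpt i))
      = ∑ i, w i * (FedOTP.empiricalLoss f ℓ (fun j => Z i j ω) PgOpt (PlOpt i)
        - FedOTP.trueLoss f ℓ (D i) PgOpt (PlOpt i))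
      + ∑ i, w i * (FedOTP.empiricalLoss f ℓ (fun j => Z i j ω) (PgHat ω) (PlHat i ω)
        - FedOTP.empiricalLoss f ℓ (fun j => Z i j ω) PgOpt (PlOpt i)) := by
    rw [← Finset.sum_add_distrib]
    exact Finset.sum_congr rfl fun i _ => by ring
  rw [hsplit]
  refine (abs_add_le _ _).trans (add_le_add (hε.trans ?_) hprompt)
  -- This covers a negative logarithm too, since `√` is 0 on negative reals.
  exact le_add_of_nonneg_right (Real.sqrt_nonneg _)
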